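/- Theorem. Let $m,n$ be natural numbers, let $\sigma>0$, and let $A$ be a random matrix with values in $\mathbb{R}^{m\times n}$ that is sub-Gaussian with variance proxy $\sigma^2$, meaning that $\mathbb{E}(A)=0$ and $$\mathbb{E}\big(e^{\lambda u^\top A v}\big)\le e^{\lambda^2\sigma^2/2}\qquad\text{for all }\lambda\in\mathbb{R}\text{ and all Euclidean unit vectors }u\in\mathbb{R}^m,\ v\in\mathbb{R}^n.$$ (The entries of $A$ are not assumed to be independent.) Then for every $\varepsilon\in(0,1)$ and every $\delta\in(0,1)$, $$\mathbb{P}\left(\|A\|\le \sigma\sqrt{\frac{\log\frac{1}{1-\varepsilon^2}}{\varepsilon^4}\,(m+n)+\frac{2}{\varepsilon^4}\log\frac{1}{\delta}}\right)\ge 1-\delta,$$ where $\|A\|$ is the operator norm of $A$ with respect to the Euclidean norms. -/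

import Mathlib

open MeasureTheory ProbabilityTheory
open scoped Matrix Matrix.Norms.L2Operator

/-- A random matrix `A` on the probability space `(Ω, μ)` is sub-Gaussian with variance proxy
`σ ^ 2` if `𝔼 A = 0` (entrywise) and, for all Euclidean unit vectors `u` and `v`, the real random
variable `uᵀ A v` satisfies `𝔼 exp (t * uᵀ A v) ≤ exp (σ ^ 2 * t ^ 2 / 2)` for every real `t`
(the expectation being finite). -/
structure IsSubGaussianMatrix {Ω : Type*} [MeasurableSpace Ω] {m n : ℕ}
    (A : Ω → Matrix (Fin m) (Fin n) ℝ) (σ : ℝ) (μ : Measure Ω) : Prop where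
  integrable_entry : ∀ i j, Integrable (fun ω => A ω i j) μ
  integral_entry : ∀ i j, ∫ ω, A ω i j ∂μ = 0
  hasSubgaussianMGF : ∀ (u : EuclideanSpace ℝ (Fin m)) (v : EuclideanSpace ℝ (Fin n)),
    ‖u‖ = 1 → ‖v‖ = 1 →
      HasSubgaussianMGF (fun ω => u.ofLp ⬝ᵥ (A ω *ᵥ v.ofLp)) (Real.toNNReal (σ ^ 2)) μ

/-! The proof tests `A` on an independent standard Gaussian vector `g` and estimates the `2K`-th
moment of `‖A g‖`, so no union bound over a net is needed. For a fixed matrix `B`, projecting `B g`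
on a unit vector `u` leaves a scalar Gaussian of standard deviation `‖Bᵀ u‖`; the Gamma bound then
makes the moment at least `(2K/e)^K r^(2K)` whenever `r < ‖B‖`
(`ofReal_opNorm_rpow_le_lintegral_norm_mulVec`). In the other direction, Tonelli lets `g` be fixed
first: the moments of `‖A g‖` given `g`, and then of `‖g‖`, are controlled by exponential moments of
squared norms, each costing a power of `1 - t`. Markov's inequality combines the two estimates, and
the final step takes `t = ε ^ 2` and chooses `K` to make the tail equal to `δ`. -/

/-! ### A lower bound for the Gamma function. -/

open Real Filter Topology in
-- Up to an additive constant this is the midpoint-rule error for the integral of `log` over `[x, x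
-- + 1]`.
theorem antitoneOn_log_midpoint_sub_integral_log :
    AntitoneOn (fun x : ℝ => log (x + 1 / 2) - (x + 1) * log (x + 1) + x * log x) (Set.Ici 0) := by
  have hc : Continuous fun x : ℝ => x * log x := continuous_mul_log
  refine antitoneOn_of_deriv_nonpos (convex_Ici 0) ?_ ?_ ?_
  · refine ContinuousOn.add (ContinuousOn.sub (ContinuousOn.log (by fun_prop) ?_)
      (hc.comp (by fun_prop : Continuous fun x : ℝ => x + 1)).continuousOn) hc.continuousOn
    intro x hx
    have : (0 : ℝ) ≤ x := hx
    positivity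
  all_goals
    rw [interior_Ici]
    have hd : ∀ x ∈ Set.Ioi (0 : ℝ), HasDerivAt
        (fun x : ℝ => log (x + 1 / 2) - (x + 1) * log (x + 1) + x * log x)
        (1 / (x + 1 / 2) - (log (x + 1) + 1) + (log x + 1)) x := by
      intro x hx
      have hx : (0 : ℝ) < x := hx
      have h1 : HasDerivAt (fun x : ℝ => log (x + 1 / 2)) (1 / (x + 1 / 2)) x :=
        ((hasDerivAt_id x).add_const (1 / 2)).log (by simp only [id]; positivity)
      have h2 : HasDerivAt (fun x : ℝ => (x + 1) * log (x + 1)) (log (x + 1) + 1) x :=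
        (hasDerivAt_mul_log (x := x + 1) (by positivity)).comp_add_const x 1
      exact (h1.sub h2).add (hasDerivAt_mul_log hx.ne')
  · exact fun x hx => (hd x hx).differentiableAt.differentiableWithinAt
  · intro x hx
    rw [(hd x hx).deriv]
    have hx : (0 : ℝ) < x := hx
    -- The sign of the derivative is the bound `2y / (y + 2) ≤ log (1 + y)` at `y = 1 / x`.
    have h := le_log_one_add_of_nonneg (x := 1 / x) (by positivity)
    have h3 : log (1 + 1 / x) = log (x + 1) - log x := by
      rw [← log_div (by positivity) hx.ne']; congr 1; field_simp
    have h4 : 2 * (1 / x) / (1 / x + 2) = 1 / (x + 1 / 2) := by field_simp; ring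
    linarith

open Real Filter Topology in
/-- A lower Stirling-type bound for the Gamma function at half-integer shifts. -/
theorem sqrt_pi_mul_rpow_le_Gamma_add_half {K : ℝ} (hK : 0 < K) :
    √π * (K / exp 1) ^ K ≤ Gamma (K + 1 / 2) := by
  have hG : 0 < Gamma (K + 1 / 2) := Gamma_pos_of_pos (by positivity)
  have h1 := BohrMollerup.tendsto_log_gamma (x := K + 1 / 2) (by positivity)
  -- Subtracting Euler's limit at `1 / 2` brings in `Gamma (1 / 2) = √π` and cancels the factorials.
  have h2 := BohrMollerup.tendsto_log_gamma (x := 1 / 2) (by positivity)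
  have h3 := h1.sub h2
  have hlow : ∀ n : ℕ, 1 ≤ n → K * log K - K + K * log (n / (K + n + 1)) ≤
      BohrMollerup.logGammaSeq (K + 1 / 2) n - BohrMollerup.logGammaSeq (1 / 2) n := by
    intro n hn
    have hn' : (0 : ℝ) < n := by exact_mod_cast hn
    have hsum : ∀ N : ℕ, ∑ m ∈ Finset.range N, (log (K + 1 / 2 + m) - log (1 / 2 + m)) ≤
        (K + N) * log (K + N) - N * log N - K * log K := by
      intro N
      induction N with
      | zero => simp
      | succ N ih =>
        rw [Finset.sum_range_succ]
        -- Comparing the midpoint errors at `N` and `K + N` bounds the new summand by the increment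
        -- of the right-hand side.
        have := antitoneOn_log_midpoint_sub_integral_log (a := (N : ℝ)) (b := K + N)
          (by simp) (by simp; positivity) (by linarith)
        simp only at this
        push_cast
        rw [show K + 1 / 2 + (N : ℝ) = K + N + 1 / 2 by ring,
          show 1 / 2 + (N : ℝ) = N + 1 / 2 by ring, ← add_assoc K]
        linarith
    have h4 := hsum (n + 1)
    rw [Finset.sum_sub_distrib] at h4
    push_cast at h4
    rw [← add_assoc K] at h4
    simp only [BohrMollerup.logGammaSeq]
    have h5 : log (n / (K + n + 1)) = log n - log (K + n + 1) :=
      log_div hn'.ne' (by positivity)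
    have h6 : (n + 1) * (log (K + n + 1) - log (n + 1)) ≤ K := by
      rw [← log_div (by positivity) (by positivity)]
      have := log_le_sub_one_of_pos (x := (K + n + 1) / (n + 1)) (by positivity)
      calc _ ≤ (n + 1) * ((K + n + 1) / (n + 1) - 1) := by gcongr
        _ = K := by field_simp; ring
    rw [h5]
    nlinarith
  have h7 : Tendsto (fun n : ℕ => K * log K - K + K * log (n / (K + n + 1))) atTop
      (𝓝 (K * log K - K + K * log 1)) := by
    refine Tendsto.const_add _ (Tendsto.const_mul _ (Tendsto.log ?_ one_ne_zero))
    have := tendsto_natCast_div_add_atTop (𝕜 := ℝ) (K + 1)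
    refine this.congr fun n => by ring_nf
  have h8 := le_of_tendsto_of_tendsto h7 h3
    (eventually_atTop.2 ⟨1, fun n hn => hlow n hn⟩)
  rw [Gamma_one_half_eq, log_one, mul_zero, add_zero] at h8
  rw [← log_le_log_iff (by positivity) hG, log_mul (by positivity) (by positivity),
    log_rpow (by positivity), log_div hK.ne' (exp_ne_zero _), log_exp]
  linarith

/-! ### Gaussian moments. -/

theorem integral_abs_rpow_gaussianReal {K : ℝ} (hK : 0 < K) :
    ∫ x, |x| ^ (2 * K) ∂gaussianReal 0 1 = 2 ^ K * Real.Gamma (K + 1 / 2) / √Real.pi := by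
  rw [integral_gaussianReal_eq_integral_smul one_ne_zero]
  have h1 : ∀ x : ℝ, gaussianPDFReal 0 1 x • |x| ^ (2 * K) =
      (√(2 * Real.pi))⁻¹ * (fun y : ℝ => y ^ (2 * K) * Real.exp (-(1 / 2) * y ^ (2 : ℝ))) |x| := by
    intro x
    simp only [gaussianPDFReal_def, smul_eq_mul, Real.rpow_two, sq_abs, NNReal.coe_one, sub_zero]
    ring_nf
  simp_rw [h1]
  rw [integral_const_mul,
    integral_comp_abs (f := fun y : ℝ => y ^ (2 * K) * Real.exp (-(1 / 2) * y ^ (2 : ℝ))),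
    integral_rpow_mul_exp_neg_mul_rpow two_pos (by linarith) (by norm_num),
    show (2 * K + 1) / 2 = K + 1 / 2 by ring, show -(2 * K + 1) / 2 = -(K + 1 / 2) by ring,
    one_div (2 : ℝ), Real.inv_rpow two_pos.le, ← Real.rpow_neg two_pos.le, neg_neg,
    Real.rpow_add two_pos, ← one_div (2 : ℝ), ← Real.sqrt_eq_rpow, Real.sqrt_mul two_pos.le]
  field_simp

theorem integral_exp_mul_sq_gaussianReal {t : ℝ} (ht : t < 1) :
    ∫ x, Real.exp (t * x ^ 2 / 2) ∂gaussianReal 0 1 = (1 - t) ^ (-(1 / 2) : ℝ) := by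
  rw [integral_gaussianReal_eq_integral_smul one_ne_zero]
  have h1 : ∀ x : ℝ, gaussianPDFReal 0 1 x • Real.exp (t * x ^ 2 / 2) =
      (√(2 * Real.pi))⁻¹ * Real.exp (-((1 - t) / 2) * x ^ 2) := by
    intro x
    simp only [gaussianPDFReal_def, smul_eq_mul, NNReal.coe_one, sub_zero]
    rw [mul_assoc, ← Real.exp_add]
    ring_nf
  have ht' : 0 < 1 - t := by linarith
  simp_rw [h1]
  rw [integral_const_mul, integral_gaussian, Real.rpow_neg ht'.le, ← Real.sqrt_eq_rpow,
    ← Real.sqrt_inv, ← Real.sqrt_inv, ← Real.sqrt_mul (by positivity)]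
  congr 1
  field_simp

theorem lintegral_exp_mul_norm_sq_stdGaussian {ι : Type*} [Fintype ι] {t : ℝ} (ht : t < 1) :
    ∫⁻ g, ENNReal.ofReal (Real.exp (t * ‖g‖ ^ 2 / 2)) ∂stdGaussian (EuclideanSpace ℝ ι) =
      ENNReal.ofReal ((1 - t) ^ (-(Fintype.card ι / 2) : ℝ)) := by
  have ht' : 0 < 1 - t := by linarith
  rw [← map_pi_eq_stdGaussian, lintegral_map (by fun_prop) (by fun_prop)]
  have h1 : ∀ x : ι → ℝ, Real.exp (t * ‖WithLp.toLp 2 x‖ ^ 2 / 2) =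
      ∏ i, Real.exp (t * x i ^ 2 / 2) := by
    intro x
    rw [EuclideanSpace.real_norm_sq_eq, ← Real.exp_sum, Finset.mul_sum, Finset.sum_div]
  simp_rw [h1]
  have hint : Integrable (fun x : ℝ => Real.exp (t * x ^ 2 / 2)) (gaussianReal 0 1) := by
    refine Integrable.of_integral_ne_zero ?_
    rw [integral_exp_mul_sq_gaussianReal ht]
    positivity
  rw [← ofReal_integral_eq_lintegral_ofReal (Integrable.fintype_prod fun _ => hint)
    (Filter.Eventually.of_forall fun x => by positivity),
    integral_fintype_prod_eq_pow (fun x : ℝ => Real.exp (t * x ^ 2 / 2)),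
    integral_exp_mul_sq_gaussianReal ht, ← Real.rpow_mul_natCast ht'.le]
  congr 2
  ring

section
variable {E : Type*} [NormedAddCommGroup E] [InnerProductSpace ℝ E] [FiniteDimensional ℝ E]
  [MeasurableSpace E] [BorelSpace E]

theorem map_inner_stdGaussian (y : E) :
    (stdGaussian E).map (fun g => inner ℝ y g) = (gaussianReal 0 1).map (‖y‖ * ·) := by
  have := IsGaussian.map_eq_gaussianReal (μ := stdGaussian E) (innerSL ℝ y)
  rw [integral_strongDual_stdGaussian, variance_dual_stdGaussian, innerSL_apply_norm] at this
  rw [gaussianReal_map_const_mul]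
  convert this using 2
  · simp
  · exact mul_zero _
  · rw [mul_one, ← NNReal.coe_inj, Real.coe_toNNReal _ (sq_nonneg _), NNReal.coe_mk]

theorem lintegral_exp_inner_stdGaussian (y : E) :
    ∫⁻ g, ENNReal.ofReal (Real.exp (inner ℝ y g)) ∂stdGaussian E =
      ENNReal.ofReal (Real.exp (‖y‖ ^ 2 / 2)) := by
  rw [← lintegral_map (μ := stdGaussian E) (f := fun x : ℝ => ENNReal.ofReal (Real.exp x))
    (g := fun g => inner ℝ y g) (by fun_prop) (by fun_prop), map_inner_stdGaussian,
    lintegral_map (by fun_prop) (by fun_prop)]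
  have h := congrFun (mgf_fun_id_gaussianReal (μ := 0) (v := 1)) ‖y‖
  simp only [mgf, zero_mul, zero_add, NNReal.coe_one, one_mul] at h
  rw [← h, ofReal_integral_eq_lintegral_ofReal _
    (Filter.Eventually.of_forall fun x => by positivity)]
  refine Integrable.of_integral_ne_zero ?_
  rw [h]
  positivity

theorem ofReal_le_lintegral_abs_inner_rpow_stdGaussian {K : ℝ} (hK : 0 < K) (y : E) :
    ENNReal.ofReal ((2 * K / Real.exp 1) ^ K * ‖y‖ ^ (2 * K)) ≤
      ∫⁻ g, ENNReal.ofReal (|inner ℝ y g| ^ (2 * K)) ∂stdGaussian E := by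
  rw [← lintegral_map (μ := stdGaussian E) (f := fun x : ℝ => ENNReal.ofReal (|x| ^ (2 * K)))
    (g := fun g => inner ℝ y g) (by fun_prop) (by fun_prop), map_inner_stdGaussian,
    lintegral_map (by fun_prop) (by fun_prop)]
  have hG : 0 < Real.Gamma (K + 1 / 2) := Real.Gamma_pos_of_pos (by positivity)
  have hint : Integrable (fun x : ℝ => |x| ^ (2 * K)) (gaussianReal 0 1) := by
    refine Integrable.of_integral_ne_zero ?_
    rw [integral_abs_rpow_gaussianReal hK]
    positivity
  have h1 : ∀ x : ℝ, |‖y‖ * x| ^ (2 * K) = ‖y‖ ^ (2 * K) * |x| ^ (2 * K) := by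
    intro x
    rw [abs_mul, abs_norm, Real.mul_rpow (norm_nonneg _) (abs_nonneg _)]
  simp_rw [h1]
  rw [← ofReal_integral_eq_lintegral_ofReal (hint.const_mul _)
    (Filter.Eventually.of_forall fun x => by positivity), integral_const_mul,
    integral_abs_rpow_gaussianReal hK, mul_comm]
  gcongr
  rw [mul_div_assoc 2, Real.mul_rpow two_pos.le (by positivity), mul_div_assoc]
  gcongr
  rw [le_div_iff₀ (by positivity), mul_comm]
  exact sqrt_pi_mul_rpow_le_Gamma_add_half hK
end

/-- The maximum of `x ^ K * exp (-b * x)` over `x ≥ 0` is attained at `x = K / b`. -/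
theorem rpow_le_mul_exp {K b x : ℝ} (hK : 0 < K) (hb : 0 < b) (hx : 0 ≤ x) :
    x ^ K ≤ (K / (Real.exp 1 * b)) ^ K * Real.exp (b * x) := by
  have h : x ≤ K / (Real.exp 1 * b) * Real.exp (b * x / K) := by
    have h1 := Real.add_one_le_exp (b * x / K - 1)
    rw [Real.exp_sub, sub_add_cancel] at h1
    calc x = K / b * (b * x / K) := by field_simp
      _ ≤ K / b * (Real.exp (b * x / K) / Real.exp 1) := by gcongr
      _ = _ := by field_simp
  calc x ^ K ≤ (K / (Real.exp 1 * b) * Real.exp (b * x / K)) ^ K := by gcongr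
    _ = _ := by
      rw [Real.mul_rpow (by positivity) (by positivity), ← Real.exp_mul]
      congr 2
      field_simp

theorem lintegral_norm_rpow_stdGaussian_le {ι : Type*} [Fintype ι] {K t : ℝ} (hK : 0 < K)
    (ht : t ∈ Set.Ioo (0 : ℝ) 1) :
    ∫⁻ g, ENNReal.ofReal (‖g‖ ^ (2 * K)) ∂stdGaussian (EuclideanSpace ℝ ι) ≤
      ENNReal.ofReal ((2 * K / (Real.exp 1 * t)) ^ K * (1 - t) ^ (-(Fintype.card ι / 2) : ℝ)) := by
  have ht0 := ht.1
  rw [ENNReal.ofReal_mul (by positivity), ← lintegral_exp_mul_norm_sq_stdGaussian ht.2,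
    ← lintegral_const_mul _ (by fun_prop)]
  refine lintegral_mono fun g => ?_
  simp only
  rw [← ENNReal.ofReal_mul (by positivity)]
  refine ENNReal.ofReal_le_ofReal ?_
  have := rpow_le_mul_exp hK (b := t / 2) (x := ‖g‖ ^ 2) (by positivity) (by positivity)
  rw [Real.rpow_mul (norm_nonneg _), Real.rpow_two]
  convert this using 3 <;> field_simp

/-! ### Moments of sub-Gaussian vectors and matrices. -/

/-- Gaussian linearization: `exp (‖y‖ ^ 2 / 2)` is the average of `exp ⟪y, g⟫`. After exchanging
integrals, the hypothesis applies for each fixed `g`, and a purely Gaussian integral remains. -/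
theorem lintegral_exp_mul_norm_sq_le_of_subgaussian {Ω ι : Type*} [MeasurableSpace Ω] [Fintype ι]
    {μ : Measure Ω} [SFinite μ] {Y : Ω → EuclideanSpace ℝ ι} (hY : AEMeasurable Y μ) {σ t : ℝ}
    (hσ : 0 < σ) (ht : t ∈ Set.Ico (0 : ℝ) 1)
    (hsub : ∀ u, ∫⁻ ω, ENNReal.ofReal (Real.exp (inner ℝ (Y ω) u)) ∂μ ≤
      ENNReal.ofReal (Real.exp (σ ^ 2 * ‖u‖ ^ 2 / 2))) :
    ∫⁻ ω, ENNReal.ofReal (Real.exp (t / σ ^ 2 * ‖Y ω‖ ^ 2 / 2)) ∂μ ≤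
      ENNReal.ofReal ((1 - t) ^ (-(Fintype.card ι / 2) : ℝ)) := by
  set s := √t / σ with hs
  have hs2 : s ^ 2 = t / σ ^ 2 := by rw [hs, div_pow, Real.sq_sqrt ht.1]
  calc ∫⁻ ω, ENNReal.ofReal (Real.exp (t / σ ^ 2 * ‖Y ω‖ ^ 2 / 2)) ∂μ
      = ∫⁻ ω, ∫⁻ g, ENNReal.ofReal (Real.exp (inner ℝ (s • Y ω) g))
          ∂stdGaussian (EuclideanSpace ℝ ι) ∂μ := by
        refine lintegral_congr fun ω => ?_
        rw [lintegral_exp_inner_stdGaussian, norm_smul, mul_pow, Real.norm_eq_abs, sq_abs, hs2]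
    _ = ∫⁻ g, ∫⁻ ω, ENNReal.ofReal (Real.exp (inner ℝ (s • Y ω) g)) ∂μ
          ∂stdGaussian (EuclideanSpace ℝ ι) := by
        refine lintegral_lintegral_swap ?_
        have h1 : AEMeasurable (fun p : Ω × EuclideanSpace ℝ ι => Y p.1)
          (μ.prod (stdGaussian (EuclideanSpace ℝ ι))) := hY.comp_fst
        exact ENNReal.measurable_ofReal.comp_aemeasurable (Real.measurable_exp.comp_aemeasurable
          ((h1.const_smul s).inner measurable_snd.aemeasurable))
    _ ≤ ∫⁻ g, ENNReal.ofReal (Real.exp (t * ‖g‖ ^ 2 / 2)) ∂stdGaussian (EuclideanSpace ℝ ι) := by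
        refine lintegral_mono fun g => ?_
        simp only [real_inner_smul_left, ← real_inner_smul_right]
        refine (hsub (s • g)).trans (le_of_eq ?_)
        rw [norm_smul, mul_pow, Real.norm_eq_abs, sq_abs, hs2]
        congr 2
        field_simp
    _ = _ := lintegral_exp_mul_norm_sq_stdGaussian ht.2

theorem lintegral_norm_rpow_le_of_subgaussian {Ω ι : Type*} [MeasurableSpace Ω] [Fintype ι]
    {μ : Measure Ω} [SFinite μ] {Y : Ω → EuclideanSpace ℝ ι} (hY : AEMeasurable Y μ) {σ t K : ℝ}
    (hσ : 0 < σ) (ht : t ∈ Set.Ioo (0 : ℝ) 1) (hK : 0 < K)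
    (hsub : ∀ u, ∫⁻ ω, ENNReal.ofReal (Real.exp (inner ℝ (Y ω) u)) ∂μ ≤
      ENNReal.ofReal (Real.exp (σ ^ 2 * ‖u‖ ^ 2 / 2))) :
    ∫⁻ ω, ENNReal.ofReal (‖Y ω‖ ^ (2 * K)) ∂μ ≤ ENNReal.ofReal
      ((2 * σ ^ 2 * K / (Real.exp 1 * t)) ^ K * (1 - t) ^ (-(Fintype.card ι / 2) : ℝ)) := by
  have ht0 := ht.1
  rw [ENNReal.ofReal_mul (by positivity)]
  refine le_trans ?_ (mul_le_mul_right
    (lintegral_exp_mul_norm_sq_le_of_subgaussian hY hσ (Set.Ioo_subset_Ico_self ht) hsub) _)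
  rw [← lintegral_const_mul' _ _ ENNReal.ofReal_ne_top]
  refine lintegral_mono fun ω => ?_
  simp only
  rw [← ENNReal.ofReal_mul (by positivity)]
  refine ENNReal.ofReal_le_ofReal ?_
  have := rpow_le_mul_exp hK (b := t / σ ^ 2 / 2) (x := ‖Y ω‖ ^ 2) (by positivity) (by positivity)
  rw [Real.rpow_mul (norm_nonneg _), Real.rpow_two]
  convert this using 3 <;> field_simp

section
variable {Ω : Type*} [MeasurableSpace Ω] {μ : Measure Ω} [IsProbabilityMeasure μ] {m n : ℕ}
  {A : Ω → Matrix (Fin m) (Fin n) ℝ} {σ : ℝ}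

theorem IsSubGaussianMatrix.lintegral_exp_inner_le (hsub : IsSubGaussianMatrix A σ μ)
    {v : EuclideanSpace ℝ (Fin n)} (hv : ‖v‖ = 1) (u : EuclideanSpace ℝ (Fin m)) :
    ∫⁻ ω, ENNReal.ofReal (Real.exp (inner ℝ (WithLp.toLp 2 (A ω *ᵥ v.ofLp)) u)) ∂μ ≤
      ENNReal.ofReal (Real.exp (σ ^ 2 * ‖u‖ ^ 2 / 2)) := by
  rcases eq_or_ne u 0 with rfl | hu
  · simp
  have hu' : ‖u‖ ≠ 0 := norm_ne_zero_iff.2 hu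
  have h := hsub.hasSubgaussianMGF (‖u‖⁻¹ • u) v (by rw [norm_smul]; simp [hu']) hv
  have h1 : ∀ ω, inner ℝ (WithLp.toLp 2 (A ω *ᵥ v.ofLp)) u =
      ‖u‖ * ((‖u‖⁻¹ • u).ofLp ⬝ᵥ (A ω *ᵥ v.ofLp)) := by
    intro ω
    rw [EuclideanSpace.inner_eq_star_dotProduct]
    simp [hu']
  simp_rw [h1]
  rw [← ofReal_integral_eq_lintegral_ofReal (h.integrable_exp_mul ‖u‖)
    (Filter.Eventually.of_forall fun x => by positivity)]
  refine ENNReal.ofReal_le_ofReal ?_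
  have := h.mgf_le ‖u‖
  rwa [Real.coe_toNNReal _ (sq_nonneg σ)] at this

theorem IsSubGaussianMatrix.lintegral_norm_mulVec_rpow_le (hsub : IsSubGaussianMatrix A σ μ)
    (hA : ∀ i j, AEMeasurable (fun ω => A ω i j) μ) {t K : ℝ}
    (hσ : 0 < σ) (ht : t ∈ Set.Ioo (0 : ℝ) 1) (hK : 0 < K) (v : EuclideanSpace ℝ (Fin n)) :
    ∫⁻ ω, ENNReal.ofReal (‖WithLp.toLp 2 (A ω *ᵥ v.ofLp)‖ ^ (2 * K)) ∂μ ≤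
      ENNReal.ofReal ((2 * σ ^ 2 * K / (Real.exp 1 * t)) ^ K * (1 - t) ^ (-(m / 2) : ℝ)) *
        ENNReal.ofReal (‖v‖ ^ (2 * K)) := by
  have h2K : 2 * K ≠ 0 := by positivity
  rcases eq_or_ne v 0 with rfl | hv
  · simp [Real.zero_rpow h2K]
  have hv' : ‖v‖ ≠ 0 := norm_ne_zero_iff.2 hv
  set w := ‖v‖⁻¹ • v with hw
  have hw1 : ‖w‖ = 1 := by rw [hw, norm_smul]; simp [hv']
  have hvw : v = ‖v‖ • w := by rw [hw, smul_smul, mul_inv_cancel₀ hv', one_smul]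
  have hY : AEMeasurable (fun ω => WithLp.toLp 2 (A ω *ᵥ w.ofLp)) μ := by
    refine (WithLp.measurable_toLp 2 _).comp_aemeasurable (aemeasurable_pi_lambda _ fun i => ?_)
    simp only [Matrix.mulVec, dotProduct]
    exact Finset.aemeasurable_fun_sum _ fun j _ => (hA i j).mul_const _
  have h := lintegral_norm_rpow_le_of_subgaussian hY hσ ht hK
    (hsub.lintegral_exp_inner_le hw1)
  rw [Fintype.card_fin] at h
  have h1 : ∀ ω, ‖WithLp.toLp 2 (A ω *ᵥ v.ofLp)‖ ^ (2 * K) =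
      ‖WithLp.toLp 2 (A ω *ᵥ w.ofLp)‖ ^ (2 * K) * ‖v‖ ^ (2 * K) := by
    intro ω
    rw [← Real.mul_rpow (norm_nonneg _) (norm_nonneg _)]
    congr 1
    conv_lhs => rw [hvw]
    rw [WithLp.ofLp_smul, Matrix.mulVec_smul, WithLp.toLp_smul, norm_smul, norm_norm, mul_comm]
  simp_rw [h1, ENNReal.ofReal_mul (Real.rpow_nonneg (norm_nonneg _) _)]
  rw [lintegral_mul_const' _ _ ENNReal.ofReal_ne_top]
  gcongr
end

/-! ### From moments to the operator norm. -/

/-- The `2K`-th Gaussian moment of `‖B g‖` dominates the `2K`-th power of the operator norm. -/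
theorem ofReal_opNorm_rpow_le_lintegral_norm_mulVec {m n : ℕ} (B : Matrix (Fin m) (Fin n) ℝ)
    {K r : ℝ} (hK : 0 < K) (hr : 0 ≤ r) (hB : r < ‖B‖) :
    ENNReal.ofReal ((2 * K / Real.exp 1) ^ K * r ^ (2 * K)) ≤
      ∫⁻ g, ENNReal.ofReal (‖WithLp.toLp 2 (B *ᵥ g.ofLp)‖ ^ (2 * K))
        ∂stdGaussian (EuclideanSpace ℝ (Fin n)) := by
  -- As `r < ‖B‖ = ‖Bᵀ‖` is strict, such a `u` exists without the norm having to be attained.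
  obtain ⟨u, hu1, hu⟩ : ∃ u : EuclideanSpace ℝ (Fin m), ‖u‖ = 1 ∧
      r < ‖(WithLp.toLp 2 (Bᵀ *ᵥ u.ofLp) : EuclideanSpace ℝ (Fin n))‖ := by
    by_contra! h
    refine hB.not_ge ?_
    rw [← Matrix.l2_opNorm_conjTranspose, Matrix.conjTranspose_eq_transpose_of_trivial,
      Matrix.l2_opNorm_def]
    refine ContinuousLinearMap.opNorm_le_of_unit_norm hr fun x hx => h x hx
  set w : EuclideanSpace ℝ (Fin n) := WithLp.toLp 2 (Bᵀ *ᵥ u.ofLp) with hw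
  calc ENNReal.ofReal ((2 * K / Real.exp 1) ^ K * r ^ (2 * K))
      ≤ ENNReal.ofReal ((2 * K / Real.exp 1) ^ K * ‖w‖ ^ (2 * K)) := by gcongr
    _ ≤ _ := ofReal_le_lintegral_abs_inner_rpow_stdGaussian hK w
    _ ≤ _ := by
        refine lintegral_mono fun g => ENNReal.ofReal_le_ofReal ?_
        gcongr
        have h1 : inner ℝ w g = inner ℝ u (WithLp.toLp 2 (B *ᵥ g.ofLp)) := by
          simp only [EuclideanSpace.inner_eq_star_dotProduct, star_trivial, hw]
          rw [Matrix.mulVec_transpose, dotProduct_comm, ← Matrix.dotProduct_mulVec,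
            dotProduct_comm]
        rw [h1]
        simpa [hu1] using abs_real_inner_le_norm u (WithLp.toLp 2 (B *ᵥ g.ofLp))

theorem IsSubGaussianMatrix.measure_opNorm_gt_le {Ω : Type*} [MeasurableSpace Ω] {μ : Measure Ω}
    [IsProbabilityMeasure μ] {m n : ℕ} {A : Ω → Matrix (Fin m) (Fin n) ℝ} {σ : ℝ}
    (hsub : IsSubGaussianMatrix A σ μ) (hA : ∀ i j, AEMeasurable (fun ω => A ω i j) μ) {t K : ℝ}
    (hσ : 0 < σ) (ht : t ∈ Set.Ioo (0 : ℝ) 1) (hK : 0 < K) :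
    μ {ω | σ * √(2 * K / t ^ 2) < ‖A ω‖} ≤
      ENNReal.ofReal (Real.exp (-K) * (1 - t) ^ (-((m + n) / 2) : ℝ)) := by
  have ht0 := ht.1
  have ht1 : 0 < 1 - t := sub_pos.2 ht.2
  set γ := stdGaussian (EuclideanSpace ℝ (Fin n))
  set f : Ω → EuclideanSpace ℝ (Fin n) → ENNReal := fun ω g =>
    ENNReal.ofReal (‖WithLp.toLp 2 (A ω *ᵥ g.ofLp)‖ ^ (2 * K))
  have hfm : AEMeasurable (Function.uncurry f) (μ.prod γ) := by
    have h1 : AEMeasurable (fun p : Ω × EuclideanSpace ℝ (Fin n) =>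
        (WithLp.toLp 2 (A p.1 *ᵥ p.2.ofLp) : EuclideanSpace ℝ (Fin m))) (μ.prod γ) := by
      refine (WithLp.measurable_toLp 2 _).comp_aemeasurable (aemeasurable_pi_lambda _ fun i => ?_)
      simp only [Matrix.mulVec, dotProduct]
      refine Finset.aemeasurable_fun_sum _ fun j _ => ?_
      have h2 : AEMeasurable (fun p : Ω × EuclideanSpace ℝ (Fin n) => A p.1 i j) (μ.prod γ) :=
        (hA i j).comp_fst
      have h3 : Measurable (fun p : Ω × EuclideanSpace ℝ (Fin n) => p.2.ofLp j) := by fun_prop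
      exact h2.mul h3.aemeasurable
    exact ENNReal.measurable_ofReal.comp_aemeasurable (h1.norm.pow_const _)
  set C₁ := (2 * σ ^ 2 * K / (Real.exp 1 * t)) ^ K * (1 - t) ^ (-(m / 2) : ℝ) with hC₁
  set C₂ := (2 * K / (Real.exp 1 * t)) ^ K * (1 - t) ^ (-(n / 2) : ℝ) with hC₂
  set c := (2 * K / Real.exp 1) ^ K * (σ * √(2 * K / t ^ 2)) ^ (2 * K) with hc
  have hc0 : 0 < c := by positivity
  have hint : ∫⁻ ω, ∫⁻ g, f ω g ∂γ ∂μ ≤ ENNReal.ofReal (C₁ * C₂) := by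
    rw [lintegral_lintegral_swap hfm, ENNReal.ofReal_mul (by positivity)]
    calc _ ≤ ∫⁻ g, ENNReal.ofReal C₁ * ENNReal.ofReal (‖g‖ ^ (2 * K)) ∂γ :=
          lintegral_mono fun g => hsub.lintegral_norm_mulVec_rpow_le hA hσ ht hK g
      _ ≤ _ := by
          rw [lintegral_const_mul' _ _ ENNReal.ofReal_ne_top]
          gcongr
          simpa using lintegral_norm_rpow_stdGaussian_le (ι := Fin n) hK ht
  have hmarkov := mul_meas_ge_le_lintegral₀ hfm.lintegral_prod_right' (ENNReal.ofReal c)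
  have hle : ENNReal.ofReal c * μ {ω | σ * √(2 * K / t ^ 2) < ‖A ω‖} ≤
      ENNReal.ofReal (C₁ * C₂) := by
    refine le_trans ?_ (hmarkov.trans hint)
    refine mul_le_mul_right (measure_mono fun ω hω => ?_) _
    exact ofReal_opNorm_rpow_le_lintegral_norm_mulVec (A ω) hK (by positivity) hω
  -- The radius was chosen so that the `K`-th powers in `C₁ * C₂ / c` collapse to exactly `exp
  -- (-K)`.
  have hCc : C₁ * C₂ = c * (Real.exp (-K) * (1 - t) ^ (-((m + n) / 2) : ℝ)) := by
    have h1 : (1 - t) ^ (-((m + n) / 2) : ℝ) =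
        (1 - t) ^ (-(m / 2) : ℝ) * (1 - t) ^ (-(n / 2) : ℝ) := by
      rw [← Real.rpow_add ht1]; ring_nf
    have h2 : (2 * σ ^ 2 * K / (Real.exp 1 * t)) ^ K * (2 * K / (Real.exp 1 * t)) ^ K =
        c * Real.exp (-K) := by
      rw [hc, Real.rpow_mul (by positivity), Real.rpow_two, mul_pow, Real.sq_sqrt (by positivity),
        show Real.exp (-K) = (Real.exp (-1)) ^ K by rw [← Real.exp_mul]; ring_nf,
        ← Real.mul_rpow (by positivity) (by positivity),
        ← Real.mul_rpow (by positivity) (by positivity),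
        ← Real.mul_rpow (by positivity) (by positivity), Real.exp_neg]
      congr 1
      field_simp
    rw [h1, hC₁, hC₂]
    linear_combination ((1 - t) ^ (-(m / 2) : ℝ) * (1 - t) ^ (-(n / 2) : ℝ)) * h2
  rw [hCc, ENNReal.ofReal_mul hc0.le] at hle
  exact (ENNReal.mul_le_mul_iff_right (by simpa using hc0) ENNReal.ofReal_ne_top).1 hle

/-- Here `‖A ω‖` is the operator norm of `A ω` with respect to the Euclidean norms
(the scoped instances `Matrix.Norms.L2Operator`). -/
theorem mainTheorem3 {Ω : Type*} [MeasurableSpace Ω] (μ : Measure Ω) [IsProbabilityMeasure μ]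
    (m n : ℕ) (A : Ω → Matrix (Fin m) (Fin n) ℝ)
    (hA : ∀ i j, AEMeasurable (fun ω => A ω i j) μ)
    (σ : ℝ) (hσ : 0 < σ) (hsub : IsSubGaussianMatrix A σ μ)
    (ε δ : ℝ) (hε : ε ∈ Set.Ioo (0 : ℝ) 1) (hδ : δ ∈ Set.Ioo (0 : ℝ) 1) :
    1 - δ ≤ μ.real {ω | ‖A ω‖ ≤ σ * √(Real.log (1 / (1 - ε ^ 2)) / ε ^ 4 * ((m : ℝ) + (n : ℝ)) +
      2 / ε ^ 4 * Real.log (1 / δ))} := by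
  have hε0 := hε.1
  have hδ0 := hδ.1
  have ht : ε ^ 2 ∈ Set.Ioo (0 : ℝ) 1 := ⟨by positivity, pow_lt_one₀ hε0.le hε.2 two_ne_zero⟩
  have ht1 : 0 < 1 - ε ^ 2 := sub_pos.2 ht.2
  have hlogε : 0 < Real.log (1 / (1 - ε ^ 2)) :=
    Real.log_pos (by rw [lt_div_iff₀ ht1]; linarith [ht.1])
  have hlogδ : 0 < Real.log (1 / δ) := Real.log_pos (by rw [lt_div_iff₀ hδ0]; linarith [hδ.2])
  -- This `K` solves `exp (-K) * (1 - ε ^ 2) ^ (-((m + n) / 2)) = δ`.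
  set K := Real.log (1 / (1 - ε ^ 2)) * ((m + n) / 2) + Real.log (1 / δ) with hKdef
  have hK : 0 < K := by positivity
  have htail := hsub.measure_opNorm_gt_le hA hσ ht hK
  have hexp : Real.exp (-K) * (1 - ε ^ 2) ^ (-((m + n) / 2) : ℝ) = δ := by
    rw [Real.rpow_def_of_pos ht1, ← Real.exp_add, hKdef, one_div, one_div, Real.log_inv,
      Real.log_inv]
    ring_nf
    exact Real.exp_log hδ0
  have hrad : 2 * K / (ε ^ 2) ^ 2 = Real.log (1 / (1 - ε ^ 2)) / ε ^ 4 * ((m : ℝ) + (n : ℝ)) +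
      2 / ε ^ 4 * Real.log (1 / δ) := by
    rw [hKdef]
    field_simp
  rw [hexp, hrad] at htail
  set τ := σ * √(Real.log (1 / (1 - ε ^ 2)) / ε ^ 4 * ((m : ℝ) + (n : ℝ)) +
      2 / ε ^ 4 * Real.log (1 / δ))
  have hunion : {ω | ‖A ω‖ ≤ τ} ∪ {ω | τ < ‖A ω‖} = Set.univ := by
    ext ω
    simpa using le_or_gt ‖A ω‖ τ
  have h1 := measureReal_union_le (μ := μ) {ω | ‖A ω‖ ≤ τ} {ω | τ < ‖A ω‖}
  rw [hunion, probReal_univ] at h1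
  have h2 : μ.real {ω | τ < ‖A ω‖} ≤ δ := ENNReal.toReal_le_of_le_ofReal hδ0.le htail
  linarith
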